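/- A \emph{WHB-algebra} is an algebra $(A,\wedge,\vee,\to,\leftarrow,0,1)$ such that $(A,\wedge,\vee,0,1)$ is a bounded distributive lattice and, for all $a,b,c\in A$: $a\to a=1$; $a\to(b\wedge c)=(a\to b)\wedge(a\to c)$; $(a\vee b)\to c=(a\to c)\wedge(b\to c)$; $(a\to b)\wedge(b\to c)\le a\to c$; $a\leftarrow a=0$; $(a\vee b)\leftarrow c=(a\leftarrow c)\vee(b\leftarrow c)$; $a\leftarrow(b\wedge c)=(a\leftarrow b)\vee(a\leftarrow c)$; $a\leftarrow c\le(a\leftarrow b)\vee(b\leftarrow c)$; $a\wedge((a\to b)\leftarrow 0)\le b$; $a\le b\vee(1\to(a\leftarrow b))$. A \emph{tense algebra} is a Boolean algebra $B$ with unary operators $G,H$ such that, with $P x=\neg H\neg x$ and $F x=\neg G\neg x$, for all $x,y\in B$: $Px\le y\iff x\le Gy$, and $Fx\le y\iff x\le Hy$. Let $\mathcal{WHB}$ and $\mathcal{TBA}$ be the varieties of all WHB-algebras and of all tense algebras. For a tense algebra $\mathbf B$, let $M(\mathbf B)$ be the WHB-algebra on the same bounded lattice with $x\to y=G(\neg x\vee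 y)$ and $x\leftarrow y=P(x\wedge\neg y)$. For a WHB-algebra $\mathbf A$, let $X(\mathbf A)$ be the set of prime filters of its lattice reduct, $\sigma(a)=\{P\in X(\mathbf A): a\in P\}$, and for $P,Q\in X(\mathbf A)$ put $$(P,Q)\in R\iff \forall a,b\,(a\to b\in P,\ a\in Q\Rightarrow b\in Q),\qquad (P,Q)\in S\iff\forall a,b\,(a\in Q,\ b\notin Q\Rightarrow a\leftarrow b\in P).$$ Let $T(\mathbf A)$ be the tense algebra of all finite unions of sets $\sigma(a)\setminus\sigma(b)$ ($a,b\in A$), with the set-theoretic Boolean operations and $G(U)=\{P: R(P)\subseteq U\}$, $H(U)=\{P: S(P)\subseteq U\}$. A variety of WHB-algebras (of tense algebras) is the class of all WHB-algebras (tense algebras) that satisfy a given set of equations in the language $\{\wedge,\vee,\to,\leftarrow,0,1\}$ (in the language $\{\wedge,\vee,\neg,G,H,0,1\}$). A variety $\mathcal N$ of tense algebras is a \emph{tense companion} of a variety $\mathcal K$ of WHB-algebras if $T(\mathbf A)\in\mathcal N$ for every $\mathbf A\in\mathcal K$ and $M(\mathbf B)\in\mathcal K$ for every $\mathbf B\in\mathcal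 N$. A variety has the \emph{finite model property} if every equation that is not valid in some member of the variety is not valid in some finite member. \textbf{Theorem.} (1) Let $\mathcal K$ be a variety of WHB-algebras and let $\mathcal N$ be a tense companion of $\mathcal K$. Then $\mathcal K$ has the finite model property if and only if $\mathcal N$ has the finite model property. (2) The variety $\mathcal{TBA}$ has the finite model property. (3) The variety $\mathcal{WHB}$ has the finite model property. -/

import Mathlib

universe u

/-- A weak Heyting algebra: a bounded distributive lattice with a strict implication. -/
class WHAlgebra (A : Type u) extends DistribLattice A, BoundedOrder A where
  /-- strict implication `a → b` -/
  imp : A → A → A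
  imp_self : ∀ a : A, imp a a = ⊤
  imp_inf : ∀ a b c : A, imp a (b ⊓ c) = imp a b ⊓ imp a c
  sup_imp : ∀ a b c : A, imp (a ⊔ b) c = imp a c ⊓ imp b c
  imp_trans : ∀ a b c : A, imp a b ⊓ imp b c ≤ imp a c

/-- A weak difference algebra: a bounded distributive lattice with a weak difference. -/
class WDAlgebra (A : Type u) extends DistribLattice A, BoundedOrder A where
  /-- weak difference `a ← b` -/
  diff : A → A → A
  diff_self : ∀ a : A, diff a a = ⊥
  sup_diff : ∀ a b c : A, diff (a ⊔ b) c = diff a c ⊔ diff b c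
  diff_inf : ∀ a b c : A, diff a (b ⊓ c) = diff a b ⊔ diff a c
  diff_trans : ∀ a b c : A, diff a c ≤ diff a b ⊔ diff b c

/-- A weak Heyting Brouwer algebra (WHB-algebra). -/
class WHBAlgebra (A : Type u) extends WHAlgebra A, WDAlgebra A where
  inf_imp_diff_le : ∀ a b : A, a ⊓ diff (imp a b) ⊥ ≤ b
  le_sup_imp_diff : ∀ a b : A, a ≤ b ⊔ imp ⊤ (diff a b)

/-- A tense (Boolean) algebra: a Boolean algebra with unary operators `G`, `H` such that
`P ⊣ G` and `F ⊣ H`, where `P x = ¬ H ¬ x` and `F x = ¬ G ¬ x`. -/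
class TenseAlgebra (B : Type u) extends BooleanAlgebra B where
  G : B → B
  H : B → B
  gc_P_G : GaloisConnection (fun x : B => (H xᶜ)ᶜ) G
  gc_F_H : GaloisConnection (fun x : B => (G xᶜ)ᶜ) H

/-! ### The WHB-algebra `M(B)` of a tense algebra `B` -/

section FunctorM

variable {B : Type u} [TenseAlgebra B]

/-- `P x = ¬ H ¬ x` in a tense algebra. -/
def TenseAlgebra.P (x : B) : B := (TenseAlgebra.H xᶜ)ᶜ

theorem TenseAlgebra.gc (x y : B) : TenseAlgebra.P x ≤ y ↔ x ≤ TenseAlgebra.G y :=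
  TenseAlgebra.gc_P_G x y

theorem TenseAlgebra.P_mono {x y : B} (h : x ≤ y) : TenseAlgebra.P x ≤ TenseAlgebra.P y :=
  TenseAlgebra.gc_P_G.monotone_l h

theorem TenseAlgebra.G_mono {x y : B} (h : x ≤ y) :
    TenseAlgebra.G x ≤ TenseAlgebra.G y :=
  TenseAlgebra.gc_P_G.monotone_u h

theorem TenseAlgebra.P_sup (x y : B) :
    TenseAlgebra.P (x ⊔ y) = TenseAlgebra.P x ⊔ TenseAlgebra.P y :=
  TenseAlgebra.gc_P_G.l_sup

theorem TenseAlgebra.G_inf (x y : B) :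
    TenseAlgebra.G (x ⊓ y) = TenseAlgebra.G x ⊓ TenseAlgebra.G y :=
  TenseAlgebra.gc_P_G.u_inf

end FunctorM

/-- The WHB-algebra structure of a tense algebra: the same bounded lattice with
`x → y = G (¬ x ∨ y)` and `x ← y = P (x ∧ ¬ y)`. -/
@[reducible] def TenseAlgebra.toWHBAlgebra (B : Type u) [TenseAlgebra B] : WHBAlgebra B where
  imp x y := TenseAlgebra.G (xᶜ ⊔ y)
  diff x y := TenseAlgebra.P (x ⊓ yᶜ)
  imp_self a := by
    rw [compl_sup_eq_top]
    exact TenseAlgebra.gc_P_G.u_top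
  imp_inf a b c := by rw [sup_inf_left, TenseAlgebra.G_inf]
  sup_imp a b c := by rw [compl_sup, sup_inf_right, TenseAlgebra.G_inf]
  imp_trans a b c := by
    rw [← TenseAlgebra.G_inf]
    apply TenseAlgebra.G_mono
    rw [inf_sup_left, inf_sup_right, inf_compl_eq_bot, sup_bot_eq]
    exact sup_le (inf_le_left.trans le_sup_left) (inf_le_right.trans le_sup_right)
  diff_self a := by
    rw [inf_compl_eq_bot]
    exact TenseAlgebra.gc_P_G.l_bot
  sup_diff a b c := by rw [inf_sup_right, TenseAlgebra.P_sup]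
  diff_inf a b c := by rw [compl_inf, inf_sup_left, TenseAlgebra.P_sup]
  diff_trans a b c := by
    rw [← TenseAlgebra.P_sup]
    apply TenseAlgebra.P_mono
    calc a ⊓ cᶜ = (a ⊓ cᶜ) ⊓ (b ⊔ bᶜ) := by simp
      _ = (a ⊓ cᶜ ⊓ b) ⊔ (a ⊓ cᶜ ⊓ bᶜ) := inf_sup_left _ _ _
      _ ≤ (a ⊓ bᶜ) ⊔ (b ⊓ cᶜ) := by
        refine sup_le (le_sup_of_le_right ?_) (le_sup_of_le_left ?_)
        · exact le_inf inf_le_right (inf_le_left.trans inf_le_right)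
        · exact le_inf (inf_le_left.trans inf_le_left) inf_le_right
  inf_imp_diff_le a b := by
    have h : TenseAlgebra.P (TenseAlgebra.G (aᶜ ⊔ b) ⊓ ⊥ᶜ) ≤ aᶜ ⊔ b := by
      rw [TenseAlgebra.gc]
      exact inf_le_left
    calc a ⊓ TenseAlgebra.P (TenseAlgebra.G (aᶜ ⊔ b) ⊓ ⊥ᶜ) ≤ a ⊓ (aᶜ ⊔ b) :=
          inf_le_inf_left _ h
      _ = a ⊓ b := by rw [inf_sup_left]; simp
      _ ≤ b := inf_le_right
  le_sup_imp_diff a b := by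
    have h : a ⊓ bᶜ ≤ TenseAlgebra.G (⊤ᶜ ⊔ TenseAlgebra.P (a ⊓ bᶜ)) := by
      rw [← TenseAlgebra.gc]
      exact le_sup_right
    calc a ≤ b ⊔ a := le_sup_right
      _ = b ⊔ a ⊓ bᶜ := by rw [sup_inf_left]; simp
      _ ≤ _ := sup_le_sup_left h _

/-! ### Prime filters and the relations `R_A`, `S_A` -/

/-- The set `X(A)` of prime filters of a bounded distributive lattice. -/
def PrimeSpectrumLat (A : Type u) [DistribLattice A] [BoundedOrder A] : Type u :=
  {F : Order.PFilter A // F.IsPrime}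

section PrimeFilters

variable {A : Type u} [DistribLattice A] [BoundedOrder A]

instance : SetLike (PrimeSpectrumLat A) A where
  coe P := (P.1 : Set A)
  coe_injective := fun _ _ h => Subtype.ext (SetLike.coe_injective h)

/-- The Stone map `σ(a) = {P ∈ X(A) | a ∈ P}`. -/
def stoneMap (a : A) : Set (PrimeSpectrumLat A) := {P | a ∈ P}

namespace PrimeSpectrumLat

theorem mem_of_le (P : PrimeSpectrumLat A) {a b : A} (h : a ≤ b) (ha : a ∈ P) : b ∈ P :=
  Order.PFilter.mem_of_le (F := P.1) h ha

theorem top_mem (P : PrimeSpectrumLat A) : (⊤ : A) ∈ P := Order.PFilter.top_mem (F := P.1)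

theorem inf_mem_iff (P : PrimeSpectrumLat A) {a b : A} : a ⊓ b ∈ P ↔ a ∈ P ∧ b ∈ P :=
  Order.PFilter.inf_mem_iff (F := P.1)

theorem bot_notMem (P : PrimeSpectrumLat A) : (⊥ : A) ∉ P := by
  obtain ⟨x, hx⟩ := P.2.compl_ideal.Nonempty
  exact fun h => hx (P.mem_of_le bot_le h)

theorem sup_mem_iff (P : PrimeSpectrumLat A) {a b : A} : a ⊔ b ∈ P ↔ a ∈ P ∨ b ∈ P := by
  constructor
  · intro h
    by_contra hc
    rw [not_or] at hc
    obtain ⟨z, hz, haz, hbz⟩ := P.2.compl_ideal.Directed a hc.1 b hc.2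
    exact hz (P.mem_of_le (sup_le haz hbz) h)
  · rintro (h | h)
    · exact P.mem_of_le le_sup_left h
    · exact P.mem_of_le le_sup_right h

/-- A subset with the usual closure properties of a prime filter is a prime filter. -/
def ofSet (s : Set A) (h_top : ⊤ ∈ s) (h_bot : ⊥ ∉ s) (h_le : ∀ a b, a ≤ b → a ∈ s → b ∈ s)
    (h_inf : ∀ a b, a ∈ s → b ∈ s → a ⊓ b ∈ s) (h_sup : ∀ a b, a ⊔ b ∈ s → a ∈ s ∨ b ∈ s) :
    PrimeSpectrumLat A :=
  ⟨(Order.IsPFilter.of_def (F := s) ⟨⊤, h_top⟩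
      (fun a ha b hb => ⟨a ⊓ b, h_inf a b ha hb, inf_le_left, inf_le_right⟩)
      (fun {a b} h ha => h_le a b h ha)).toPFilter,
    ⟨⟨fun a b hba ha hb => ha (h_le b a hba hb), ⟨⊥, h_bot⟩,
      fun a ha b hb => ⟨a ⊔ b, fun h => (h_sup a b h).elim ha hb, le_sup_left, le_sup_right⟩⟩⟩⟩

theorem mem_ofSet {s : Set A} {h1 h2 h3 h4 h5} {a : A} :
    a ∈ ofSet s h1 h2 h3 h4 h5 ↔ a ∈ s := Iff.rfl

/-- A prime filter theorem relative to a lattice-compatible preorder `r` coarser than `≤`. -/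
theorem exists_of_not_rel (r : A → A → Prop) (r_le : ∀ x y, x ≤ y → r x y)
    (r_trans : ∀ x y z, r x y → r y z → r x z)
    (r_inf : ∀ x y z, r x y → r x z → r x (y ⊓ z))
    (r_sup : ∀ x y z, r x z → r y z → r (x ⊔ y) z) {a b : A} (hab : ¬ r a b) :
    ∃ Q : PrimeSpectrumLat A, a ∈ Q ∧ b ∉ Q ∧ ∀ x y, r x y → x ∈ Q → y ∈ Q := by
  let S : Set (Set A) := {s | (∀ x y, r x y → x ∈ s → y ∈ s) ∧
    (∀ x y, x ∈ s → y ∈ s → x ⊓ y ∈ s) ∧ b ∉ s}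
  have hmem : {x | r a x} ∈ S :=
    ⟨fun x y hxy hx => r_trans _ _ _ hx hxy, fun x y hx hy => r_inf _ _ _ hx hy, hab⟩
  obtain ⟨m, ham, hm⟩ := zorn_subset_nonempty S (by
    intro c hcS hc _
    refine ⟨⋃₀ c, ⟨?_, ?_, ?_⟩, fun s hs => Set.subset_sUnion_of_mem hs⟩
    · rintro x y hxy ⟨s, hs, hx⟩
      exact ⟨s, hs, (hcS hs).1 x y hxy hx⟩
    · rintro x y ⟨s, hs, hx⟩ ⟨t, ht, hy⟩
      rcases hc.total hs ht with h | h
      · exact ⟨t, ht, (hcS ht).2.1 x y (h hx) hy⟩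
      · exact ⟨s, hs, (hcS hs).2.1 x y hx (h hy)⟩
    · rintro ⟨s, hs, hb⟩
      exact (hcS hs).2.2 hb) _ hmem
  obtain ⟨⟨hr, hinf, hb⟩, hmax⟩ := hm
  have ha : a ∈ m := ham (r_le a a le_rfl)
  have key : ∀ x, x ∉ m → ∃ q ∈ m, r (q ⊓ x) b := by
    intro x hx
    by_contra hcon
    push Not at hcon
    have hn : {z | ∃ q ∈ m, r (q ⊓ x) z} ∈ S := by
      refine ⟨?_, ?_, ?_⟩
      · rintro y z hyz ⟨q, hq, h⟩
        exact ⟨q, hq, r_trans _ _ _ h hyz⟩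
      · rintro y z ⟨q, hq, h⟩ ⟨p, hp, h'⟩
        refine ⟨q ⊓ p, hinf q p hq hp, r_inf _ _ _ ?_ ?_⟩
        · exact r_trans _ _ _ (r_le _ _ (inf_le_inf_right _ inf_le_left)) h
        · exact r_trans _ _ _ (r_le _ _ (inf_le_inf_right _ inf_le_right)) h'
      · rintro ⟨q, hq, h⟩
        exact hcon q hq h
    have hsub : m ⊆ {z | ∃ q ∈ m, r (q ⊓ x) z} :=
      fun z hz => ⟨z, hz, r_le _ _ inf_le_left⟩
    exact hx (hmax hn hsub ⟨a, ha, r_le _ _ inf_le_right⟩)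
  refine ⟨ofSet m (hr a ⊤ (r_le _ _ le_top) ha) (fun h => hb (hr ⊥ b (r_le _ _ bot_le) h))
    (fun x y h hx => hr x y (r_le _ _ h) hx) hinf ?_, ha, hb, hr⟩
  intro x y hxy
  by_contra hcon
  rw [not_or] at hcon
  obtain ⟨q, hq, h⟩ := key x hcon.1
  obtain ⟨p, hp, h'⟩ := key y hcon.2
  refine hb (hr ((q ⊓ p) ⊓ (x ⊔ y)) b ?_ (hinf _ _ (hinf _ _ hq hp) hxy))
  rw [inf_sup_left]
  refine r_sup _ _ _ ?_ ?_
  · exact r_trans _ _ _ (r_le _ _ (inf_le_inf_right _ inf_le_left)) h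
  · exact r_trans _ _ _ (r_le _ _ (inf_le_inf_right _ inf_le_right)) h'

end PrimeSpectrumLat

/-- The free Boolean extension of a bounded distributive lattice: the Boolean algebra of subsets
of `X(A)` generated by the sets `σ(a)`. -/
def freeBooleanExtension (A : Type u) [DistribLattice A] [BoundedOrder A] :
    BooleanSubalgebra (Set (PrimeSpectrumLat A)) :=
  BooleanSubalgebra.closure (Set.range (stoneMap (A := A)))

theorem isSublattice_range_stoneMap : IsSublattice (Set.range (stoneMap (A := A))) := by
  constructor
  · rintro _ ⟨a, rfl⟩ _ ⟨b, rfl⟩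
    exact ⟨a ⊔ b, Set.ext fun P => P.sup_mem_iff⟩
  · rintro _ ⟨a, rfl⟩ _ ⟨b, rfl⟩
    exact ⟨a ⊓ b, Set.ext fun P => P.inf_mem_iff⟩

theorem bot_mem_range_stoneMap : (⊥ : Set (PrimeSpectrumLat A)) ∈ Set.range (stoneMap (A := A)) :=
  ⟨⊥, Set.eq_empty_of_forall_notMem fun P => P.bot_notMem⟩

theorem top_mem_range_stoneMap : (⊤ : Set (PrimeSpectrumLat A)) ∈ Set.range (stoneMap (A := A)) :=
  ⟨⊤, Set.eq_univ_of_forall fun P => P.top_mem⟩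

/-- The elements of the free Boolean extension are exactly the finite unions of sets
`σ(a) \ σ(b)`. -/
theorem mem_freeBooleanExtension_iff {U : Set (PrimeSpectrumLat A)} :
    U ∈ freeBooleanExtension A ↔
      ∃ t : Finset (A × A), U = ⋃ p ∈ t, stoneMap p.1 \ stoneMap p.2 := by
  classical
  constructor
  · intro h
    refine BooleanSubalgebra.closure_sdiff_sup_induction
      (p := fun U _ => ∃ t : Finset (A × A), U = ⋃ p ∈ t, stoneMap p.1 \ stoneMap p.2)
      isSublattice_range_stoneMap bot_mem_range_stoneMap top_mem_range_stoneMap ?_ ?_ U h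
    · rintro _ ⟨a, rfl⟩ _ ⟨b, rfl⟩
      exact ⟨{(a, b)}, by simp⟩
    · rintro _ _ _ _ ⟨s, rfl⟩ ⟨t, rfl⟩
      exact ⟨s ∪ t, by rw [Finset.set_biUnion_union]; rfl⟩
  · rintro ⟨t, rfl⟩
    exact BooleanSubalgebra.biSup_mem t.finite_toSet fun p _ =>
      BooleanSubalgebra.sdiff_mem (BooleanSubalgebra.subset_closure ⟨p.1, rfl⟩)
        (BooleanSubalgebra.subset_closure ⟨p.2, rfl⟩)

end PrimeFilters

section FunctorT

variable {A : Type u} [WHBAlgebra A]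

/-- `(P, Q) ∈ R_A` iff for all `a`, `b`: `a → b ∈ P` and `a ∈ Q` imply `b ∈ Q`. -/
def relR (P Q : PrimeSpectrumLat A) : Prop :=
  ∀ a b : A, WHAlgebra.imp a b ∈ P → a ∈ Q → b ∈ Q

/-- `(P, Q) ∈ S_A` iff for all `a`, `b`: `a ∈ Q` and `b ∉ Q` imply `a ← b ∈ P`. -/
def relS (P Q : PrimeSpectrumLat A) : Prop :=
  ∀ a b : A, a ∈ Q → b ∉ Q → WDAlgebra.diff a b ∈ P

theorem exists_relR {P : PrimeSpectrumLat A} {a b : A} (h : WHAlgebra.imp a b ∉ P) :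
    ∃ Q, relR P Q ∧ a ∈ Q ∧ b ∉ Q := by
  obtain ⟨Q, ha, hb, hQ⟩ := PrimeSpectrumLat.exists_of_not_rel
    (fun x y : A => WHAlgebra.imp x y ∈ P)
    (fun x y hxy => by
      have h1 := WHAlgebra.imp_inf x x y
      rw [inf_eq_left.mpr hxy, WHAlgebra.imp_self, top_inf_eq] at h1
      rw [← h1]
      exact P.top_mem)
    (fun x y z h1 h2 => P.mem_of_le (WHAlgebra.imp_trans x y z) (P.inf_mem_iff.mpr ⟨h1, h2⟩))
    (fun x y z h1 h2 => by
      rw [WHAlgebra.imp_inf]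
      exact P.inf_mem_iff.mpr ⟨h1, h2⟩)
    (fun x y z h1 h2 => by
      rw [WHAlgebra.sup_imp]
      exact P.inf_mem_iff.mpr ⟨h1, h2⟩) h
  exact ⟨Q, hQ, ha, hb⟩

theorem exists_relS {P : PrimeSpectrumLat A} {a b : A} (h : WDAlgebra.diff a b ∈ P) :
    ∃ Q, relS P Q ∧ a ∈ Q ∧ b ∉ Q := by
  obtain ⟨Q, ha, hb, hQ⟩ := PrimeSpectrumLat.exists_of_not_rel
    (fun x y : A => WDAlgebra.diff x y ∉ P)
    (fun x y hxy => by
      have h1 := WDAlgebra.sup_diff x y y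
      rw [sup_eq_right.mpr hxy, WDAlgebra.diff_self, sup_bot_eq] at h1
      rw [← h1]
      exact P.bot_notMem)
    (fun x y z h1 h2 h3 =>
      (P.sup_mem_iff.mp (P.mem_of_le (WDAlgebra.diff_trans x y z) h3)).elim h1 h2)
    (fun x y z h1 h2 h3 => by
      rw [WDAlgebra.diff_inf] at h3
      exact (P.sup_mem_iff.mp h3).elim h1 h2)
    (fun x y z h1 h2 h3 => by
      rw [WDAlgebra.sup_diff] at h3
      exact (P.sup_mem_iff.mp h3).elim h1 h2) (not_not.mpr h)
  exact ⟨Q, fun x y hx hy => by_contra fun hn => hy (hQ x y hn hx), ha, hb⟩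

theorem relS_iff_relR {P Q : PrimeSpectrumLat A} : relS P Q ↔ relR Q P := by
  constructor
  · intro h a b hab ha
    exact P.mem_of_le (WHBAlgebra.inf_imp_diff_le a b)
      (P.inf_mem_iff.mpr ⟨ha, h _ _ hab Q.bot_notMem⟩)
  · intro h a b ha hb
    have h1 := Q.mem_of_le (WHBAlgebra.le_sup_imp_diff a b) ha
    exact h _ _ ((Q.sup_mem_iff.mp h1).resolve_left hb) P.top_mem

/-- `G_A(U) = {P | R_A(P) ⊆ U}`. -/
def boxR (U : Set (PrimeSpectrumLat A)) : Set (PrimeSpectrumLat A) :=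
  {P | ∀ Q, relR P Q → Q ∈ U}

/-- `H_A(U) = {P | S_A(P) ⊆ U}`. -/
def boxS (U : Set (PrimeSpectrumLat A)) : Set (PrimeSpectrumLat A) :=
  {P | ∀ Q, relS P Q → Q ∈ U}

theorem boxR_compl_sdiff (a b : A) :
    boxR (stoneMap a \ stoneMap b)ᶜ = stoneMap (WHAlgebra.imp a b) := by
  ext P
  constructor
  · intro h
    by_contra hn
    obtain ⟨Q, hQ, ha, hb⟩ := exists_relR hn
    exact h Q hQ ⟨ha, hb⟩
  · rintro h Q hQ ⟨ha, hb⟩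
    exact hb (hQ a b h ha)

theorem boxS_compl_sdiff (a b : A) :
    boxS (stoneMap a \ stoneMap b)ᶜ = (stoneMap (WDAlgebra.diff a b))ᶜ := by
  ext P
  constructor
  · intro h hn
    obtain ⟨Q, hQ, ha, hb⟩ := exists_relS hn
    exact h Q hQ ⟨ha, hb⟩
  · rintro h Q hQ ⟨ha, hb⟩
    exact h (hQ a b ha hb)

theorem boxR_inf (U V : Set (PrimeSpectrumLat A)) : boxR (U ⊓ V) = boxR U ⊓ boxR V := by
  ext P
  exact ⟨fun h => ⟨fun Q hQ => (h Q hQ).1, fun Q hQ => (h Q hQ).2⟩,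
    fun h Q hQ => ⟨h.1 Q hQ, h.2 Q hQ⟩⟩

theorem boxS_inf (U V : Set (PrimeSpectrumLat A)) : boxS (U ⊓ V) = boxS U ⊓ boxS V := by
  ext P
  exact ⟨fun h => ⟨fun Q hQ => (h Q hQ).1, fun Q hQ => (h Q hQ).2⟩,
    fun h Q hQ => ⟨h.1 Q hQ, h.2 Q hQ⟩⟩

theorem stoneMap_mem (a : A) : stoneMap a ∈ freeBooleanExtension A :=
  BooleanSubalgebra.subset_closure ⟨a, rfl⟩

theorem boxR_mem {U : Set (PrimeSpectrumLat A)} (hU : U ∈ freeBooleanExtension A) :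
    boxR U ∈ freeBooleanExtension A := by
  have key : ∀ V ∈ freeBooleanExtension A, boxR Vᶜ ∈ freeBooleanExtension A := by
    intro V hV
    refine BooleanSubalgebra.closure_sdiff_sup_induction
      (p := fun V _ => boxR Vᶜ ∈ freeBooleanExtension A)
      isSublattice_range_stoneMap bot_mem_range_stoneMap top_mem_range_stoneMap ?_ ?_ V hV
    · rintro _ ⟨a, rfl⟩ _ ⟨b, rfl⟩
      rw [boxR_compl_sdiff]
      exact stoneMap_mem _
    · intro x _ y _ hx hy
      rw [compl_sup, boxR_inf]
      exact BooleanSubalgebra.inf_mem hx hy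
  simpa using key Uᶜ (BooleanSubalgebra.compl_mem hU)

theorem boxS_mem {U : Set (PrimeSpectrumLat A)} (hU : U ∈ freeBooleanExtension A) :
    boxS U ∈ freeBooleanExtension A := by
  have key : ∀ V ∈ freeBooleanExtension A, boxS Vᶜ ∈ freeBooleanExtension A := by
    intro V hV
    refine BooleanSubalgebra.closure_sdiff_sup_induction
      (p := fun V _ => boxS Vᶜ ∈ freeBooleanExtension A)
      isSublattice_range_stoneMap bot_mem_range_stoneMap top_mem_range_stoneMap ?_ ?_ V hV
    · rintro _ ⟨a, rfl⟩ _ ⟨b, rfl⟩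
      rw [boxS_compl_sdiff]
      exact BooleanSubalgebra.compl_mem (stoneMap_mem _)
    · intro x _ y _ hx hy
      rw [compl_sup, boxS_inf]
      exact BooleanSubalgebra.inf_mem hx hy
  simpa using key Uᶜ (BooleanSubalgebra.compl_mem hU)

end FunctorT

/-- The free tense extension `T(A)` of a WHB-algebra: the free Boolean extension of its lattice
reduct with the operators `G_A` and `H_A`. -/
@[reducible] def freeTenseExtension (A : Type u) [WHBAlgebra A] :
    TenseAlgebra (freeBooleanExtension A) where
  G U := ⟨boxR U.1, boxR_mem U.2⟩
  H U := ⟨boxS U.1, boxS_mem U.2⟩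
  gc_P_G := by
    rintro ⟨U, hU⟩ ⟨V, hV⟩
    constructor
    · intro h P hP Q hQ
      exact h (show ¬ ∀ Z, relS Q Z → Z ∈ Uᶜ from fun hc => hc P (relS_iff_relR.mpr hQ) hP)
    · intro h P hP
      have hP' : ¬ ∀ Z, relS P Z → Z ∈ Uᶜ := hP
      push Not at hP'
      obtain ⟨Z, hZ, hZU⟩ := hP'
      exact h (not_not.mp hZU) P (relS_iff_relR.mp hZ)
  gc_F_H := by
    rintro ⟨U, hU⟩ ⟨V, hV⟩
    constructor
    · intro h P hP Q hQ
      exact h (show ¬ ∀ Z, relR Q Z → Z ∈ Uᶜ from fun hc => hc P (relS_iff_relR.mp hQ) hP)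
    · intro h P hP
      have hP' : ¬ ∀ Z, relR P Z → Z ∈ Uᶜ := hP
      push Not at hP'
      obtain ⟨Z, hZ, hZU⟩ := hP'
      exact h (not_not.mp hZU) P (relS_iff_relR.mpr hZ)

/-! ### Bundled algebras, terms, equations, varieties -/

/-- WHB-algebras with carrier in `Type u`. -/
structure WHBAlg : Type (u + 1) where
  carrier : Type u
  [str : WHBAlgebra carrier]

attribute [instance] WHBAlg.str

/-- Tense algebras with carrier in `Type u`. -/
structure TenseAlg : Type (u + 1) where
  carrier : Type u
  [str : TenseAlgebra carrier]

attribute [instance] TenseAlg.str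

/-- The free tense extension `T(A)`. -/
def WHBAlg.T (A : WHBAlg.{u}) : TenseAlg.{u} :=
  @TenseAlg.mk (freeBooleanExtension A.carrier) (freeTenseExtension A.carrier)

/-- The tense algebra `B` regarded as a WHB-algebra `M(B)`. -/
def TenseAlg.M (B : TenseAlg.{u}) : WHBAlg.{u} :=
  @WHBAlg.mk B.carrier (TenseAlgebra.toWHBAlgebra B.carrier)

/-- Terms in the language `{∧, ∨, →, ←, 0, 1}` over the variables `x_0, x_1, …`. -/
inductive WHBTerm : Type
  | var : ℕ → WHBTerm
  | inf : WHBTerm → WHBTerm → WHBTerm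
  | sup : WHBTerm → WHBTerm → WHBTerm
  | imp : WHBTerm → WHBTerm → WHBTerm
  | diff : WHBTerm → WHBTerm → WHBTerm
  | bot : WHBTerm
  | top : WHBTerm

/-- Value of a term in a WHB-algebra under an assignment `v`. -/
def WHBTerm.eval {A : Type u} [WHBAlgebra A] (v : ℕ → A) : WHBTerm → A
  | .var n => v n
  | .inf s t => s.eval v ⊓ t.eval v
  | .sup s t => s.eval v ⊔ t.eval v
  | .imp s t => WHAlgebra.imp (s.eval v) (t.eval v)
  | .diff s t => WDAlgebra.diff (s.eval v) (t.eval v)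
  | .bot => ⊥
  | .top => ⊤

/-- Terms in the language `{∧, ∨, ¬, G, H, 0, 1}` over the variables `x_0, x_1, …`. -/
inductive TenseTerm : Type
  | var : ℕ → TenseTerm
  | inf : TenseTerm → TenseTerm → TenseTerm
  | sup : TenseTerm → TenseTerm → TenseTerm
  | compl : TenseTerm → TenseTerm
  | G : TenseTerm → TenseTerm
  | H : TenseTerm → TenseTerm
  | bot : TenseTerm
  | top : TenseTerm

/-- Value of a term in a tense algebra under an assignment `v`. -/
def TenseTerm.eval {B : Type u} [TenseAlgebra B] (v : ℕ → B) : TenseTerm → B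
  | .var n => v n
  | .inf s t => s.eval v ⊓ t.eval v
  | .sup s t => s.eval v ⊔ t.eval v
  | .compl s => (s.eval v)ᶜ
  | .G s => TenseAlgebra.G (s.eval v)
  | .H s => TenseAlgebra.H (s.eval v)
  | .bot => ⊥
  | .top => ⊤

/-- The equation `e.1 ≈ e.2` is valid in the WHB-algebra `A`. -/
def WHBAlg.Validates (A : WHBAlg.{u}) (e : WHBTerm × WHBTerm) : Prop :=
  ∀ v : ℕ → A.carrier, e.1.eval v = e.2.eval v

/-- The equation `e.1 ≈ e.2` is valid in the tense algebra `B`. -/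
def TenseAlg.Validates (B : TenseAlg.{u}) (e : TenseTerm × TenseTerm) : Prop :=
  ∀ v : ℕ → B.carrier, e.1.eval v = e.2.eval v

/-- A variety of WHB-algebras: all WHB-algebras satisfying some set of equations. -/
def IsVarietyWHB (K : Set WHBAlg.{u}) : Prop :=
  ∃ E : Set (WHBTerm × WHBTerm), K = {A | ∀ e ∈ E, A.Validates e}

/-- A variety of tense algebras: all tense algebras satisfying some set of equations. -/
def IsVarietyTense (N : Set TenseAlg.{u}) : Prop :=
  ∃ E : Set (TenseTerm × TenseTerm), N = {B | ∀ e ∈ E, B.Validates e}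

/-- The finite model property of a class of WHB-algebras: every equation that is not valid in
some member is not valid in some finite member. -/
def HasFMPWHB (K : Set WHBAlg.{u}) : Prop :=
  ∀ e : WHBTerm × WHBTerm, (∃ A ∈ K, ¬ A.Validates e) →
    ∃ A ∈ K, Finite A.carrier ∧ ¬ A.Validates e

/-- The finite model property of a class of tense algebras. -/
def HasFMPTense (N : Set TenseAlg.{u}) : Prop :=
  ∀ e : TenseTerm × TenseTerm, (∃ B ∈ N, ¬ B.Validates e) →
    ∃ B ∈ N, Finite B.carrier ∧ ¬ B.Validates e

/-- The variety `N` of tense algebras is a tense companion of the variety `K` of WHB-algebras: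
`T(K) ⊆ N` and `M(N) ⊆ K`. -/
structure IsTenseCompanion (N : Set TenseAlg.{u}) (K : Set WHBAlg.{u}) : Prop where
  isVariety : IsVarietyTense N
  image_T_subset : WHBAlg.T '' K ⊆ N
  image_M_subset : TenseAlg.M '' N ⊆ K

/-! Equations can be translated in both directions. A WHB-term is a tense term read in `M(B)`.
Conversely, on assignments coming from a homomorphism `f : A → M(B)`, every tense term is a finite
meet of clauses `¬ f s ∨ f t` with `s`, `t` WHB-terms: Boolean operations preserve this form, `G`
and `H` preserve finite meets, and `G(¬ f s ∨ f t) = f(s → t)`, `H(¬ f s ∨ f t) = ¬ f(s ← t)`. So a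
tense equation amounts to finitely many WHB-equations `s ∧ t ≈ s` under `f`
(`IsHomToM.eval_eq_iff`).

The Stone map embeds `A` into `M(T(A))`, and `T(A)` is finite when `A` is. Hence `T` and `M` carry
refutations, and finite refutations, between `K` and `N`, which gives (1).

For (2), a refutation in `B` survives in the finite Boolean subalgebra `C` generated by the values
of all subterms, with `G x` and `H x` replaced by the greatest elements of `C` below them
(`TenseAlgebra.eval_filtration`). Then (3) follows from (1) and (2), the class of all tense algebras
being a companion of the class of all WHB-algebras. -/

theorem TenseAlgebra.H_inf {B : Type u} [TenseAlgebra B] (x y : B) :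
    TenseAlgebra.H (x ⊓ y) = TenseAlgebra.H x ⊓ TenseAlgebra.H y :=
  TenseAlgebra.gc_F_H.u_inf

/-! ### Homomorphisms from a WHB-algebra to `M(B)` -/

/-- The map `f` is a homomorphism from the WHB-algebra `A` to the WHB-algebra `M(B)`. -/
structure IsHomToM {A B : Type u} [WHBAlgebra A] [TenseAlgebra B] (f : A → B) : Prop where
  map_inf : ∀ a b, f (a ⊓ b) = f a ⊓ f b
  map_sup : ∀ a b, f (a ⊔ b) = f a ⊔ f b
  map_bot : f ⊥ = ⊥
  map_top : f ⊤ = ⊤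
  map_imp : ∀ a b, f (WHAlgebra.imp a b) = TenseAlgebra.G ((f a)ᶜ ⊔ f b)
  map_diff : ∀ a b, f (WDAlgebra.diff a b) = TenseAlgebra.P (f a ⊓ (f b)ᶜ)

theorem isHomToM_id (B : TenseAlg.{u}) :
    IsHomToM (A := B.M.carrier) (B := B.carrier) (fun x => x) :=
  ⟨fun _ _ => rfl, fun _ _ => rfl, rfl, rfl, fun _ _ => rfl, fun _ _ => rfl⟩

/-- The Stone map as a map from `A` to `T(A)`. -/
def WHBAlg.toT (A : WHBAlg.{u}) (a : A.carrier) : A.T.carrier :=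
  ⟨stoneMap a, stoneMap_mem a⟩

/-- For `→` and `←` the prime filter theorem is needed; it enters through `boxR_compl_sdiff` and
`boxS_compl_sdiff`. -/
theorem WHBAlg.isHomToM_toT (A : WHBAlg.{u}) : IsHomToM A.toT where
  map_inf _ _ := Subtype.ext (Set.ext fun P => P.inf_mem_iff)
  map_sup _ _ := Subtype.ext (Set.ext fun P => P.sup_mem_iff)
  map_bot := Subtype.ext (Set.eq_empty_of_forall_notMem fun P => P.bot_notMem)
  map_top := Subtype.ext (Set.eq_univ_of_forall fun P => P.top_mem)
  map_imp a b := Subtype.ext (by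
    change stoneMap (WHAlgebra.imp a b) = boxR ((stoneMap a)ᶜ ⊔ stoneMap b)
    rw [← boxR_compl_sdiff, sdiff_eq, compl_inf, compl_compl])
  map_diff a b := Subtype.ext (by
    change stoneMap (WDAlgebra.diff a b) = (boxS (stoneMap a ⊓ (stoneMap b)ᶜ)ᶜ)ᶜ
    rw [← sdiff_eq, boxS_compl_sdiff, compl_compl])

theorem WHBAlg.toT_injective (A : WHBAlg.{u}) : Function.Injective A.toT := by
  have key : ∀ a b : A.carrier, A.toT a = A.toT b → a ≤ b := by
    intro a b h
    by_contra hab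
    -- With the order itself as the preorder, this is the classical prime filter separation.
    obtain ⟨Q, ha, hb, -⟩ := PrimeSpectrumLat.exists_of_not_rel (fun x y : A.carrier => x ≤ y)
      (fun _ _ h => h) (fun _ _ _ => le_trans) (fun _ _ _ => le_inf) (fun _ _ _ => sup_le) hab
    exact hb ((Set.ext_iff.mp (congrArg Subtype.val h) Q).mp ha)
  exact fun a b h => le_antisymm (key a b h) (key b a h.symm)

theorem WHBAlg.finite_T (A : WHBAlg.{u}) [Finite A.carrier] : Finite A.T.carrier := by
  have : Finite (PrimeSpectrumLat A.carrier) :=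
    Finite.of_injective (fun P => (P : Set A.carrier)) SetLike.coe_injective
  exact Subtype.finite

/-! ### Translation of WHB-terms into tense terms -/

/-- The tense term that defines the value of a WHB-term in `M(B)`. -/
def WHBTerm.toTense : WHBTerm → TenseTerm
  | .var n => .var n
  | .inf s t => .inf s.toTense t.toTense
  | .sup s t => .sup s.toTense t.toTense
  | .imp s t => .G (.sup (.compl s.toTense) t.toTense)
  | .diff s t => .compl (.H (.compl (.inf s.toTense (.compl t.toTense))))
  | .bot => .bot
  | .top => .top

/-- Used with `f` the identity of `M(B)` and with `f` the Stone map into `T(A)`. -/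
theorem IsHomToM.eval_toTense {A B : Type u} [WHBAlgebra A] [TenseAlgebra B] {f : A → B}
    (hf : IsHomToM f) (v : ℕ → A) (t : WHBTerm) :
    t.toTense.eval (f ∘ v) = f (t.eval v) := by
  induction t with
  | var n => rfl
  | inf s t hs ht => simp only [WHBTerm.toTense, TenseTerm.eval, WHBTerm.eval, hf.map_inf, hs, ht]
  | sup s t hs ht => simp only [WHBTerm.toTense, TenseTerm.eval, WHBTerm.eval, hf.map_sup, hs, ht]
  | imp s t hs ht => simp only [WHBTerm.toTense, TenseTerm.eval, WHBTerm.eval, hf.map_imp, hs, ht]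
  | diff s t hs ht =>
    simp only [WHBTerm.toTense, TenseTerm.eval, WHBTerm.eval, hf.map_diff, hs, ht, TenseAlgebra.P]
  | bot => exact hf.map_bot.symm
  | top => exact hf.map_top.symm

theorem TenseAlg.validates_toTense_iff (B : TenseAlg.{u}) (e : WHBTerm × WHBTerm) :
    B.Validates (e.1.toTense, e.2.toTense) ↔ B.M.Validates e := by
  have h := (isHomToM_id B).eval_toTense
  exact forall_congr' fun v => by
    rw [← h v e.1, ← h v e.2]
    rfl

theorem WHBAlg.validates_of_T {A : WHBAlg.{u}} {e : WHBTerm × WHBTerm}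
    (h : A.T.Validates (e.1.toTense, e.2.toTense)) : A.Validates e := by
  intro v
  apply A.toT_injective
  rw [← A.isHomToM_toT.eval_toTense, ← A.isHomToM_toT.eval_toTense]
  exact h _

/-! ### Conjunctive normal forms of tense terms -/

/-- A clause `(s, t)` of WHB-terms stands for `¬ s ∨ t`, a list of clauses for their meet. -/
abbrev WHBClauses : Type := List (WHBTerm × WHBTerm)

namespace WHBClauses

/-- The value of a list of clauses under an assignment, transported along a map `f`. -/
def eval {A B : Type u} [WHBAlgebra A] [TenseAlgebra B] (f : A → B) (v : ℕ → A) :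
    WHBClauses → B
  | [] => ⊤
  | c :: l => ((f (c.1.eval v))ᶜ ⊔ f (c.2.eval v)) ⊓ eval f v l

/-- Clauses for the join of a clause and a list of clauses. -/
def supClause (c : WHBTerm × WHBTerm) (l : WHBClauses) : WHBClauses :=
  l.map fun d => (.inf c.1 d.1, .sup c.2 d.2)

/-- Clauses for the join of two lists of clauses. -/
def sup : WHBClauses → WHBClauses → WHBClauses
  | [], _ => []
  | c :: l, m => supClause c m ++ sup l m

/-- Clauses for the complement of a list of clauses. -/
def compl : WHBClauses → WHBClauses
  | [] => [(.top, .bot)]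
  | c :: l => supClause (.top, c.1) (compl l) ++ supClause (c.2, .bot) (compl l)

/-- Clauses for `G` of a list of clauses. -/
def box (l : WHBClauses) : WHBClauses :=
  l.map fun c => (.top, .imp c.1 c.2)

/-- Clauses for `H` of a list of clauses. -/
def backBox (l : WHBClauses) : WHBClauses :=
  l.map fun c => (.diff c.1 c.2, .bot)

variable {A B : Type u} [WHBAlgebra A] [TenseAlgebra B] {f : A → B} (hf : IsHomToM f) (v : ℕ → A)

theorem eval_append (l m : WHBClauses) : eval f v (l ++ m) = eval f v l ⊓ eval f v m := by
  induction l with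
  | nil => exact (top_inf_eq _).symm
  | cons c l ih => simp only [List.cons_append, eval, ih, inf_assoc]

include hf

/-- Two clauses join to one: `(¬ s ∨ t) ∨ (¬ s' ∨ t') = ¬ (s ∧ s') ∨ (t ∨ t')`; then distribute over
the meet. -/
theorem eval_supClause (c : WHBTerm × WHBTerm) (l : WHBClauses) :
    eval f v (supClause c l) = ((f (c.1.eval v))ᶜ ⊔ f (c.2.eval v)) ⊔ eval f v l := by
  induction l with
  | nil => exact (sup_top_eq _).symm
  | cons d l ih =>
    simp only [supClause, List.map_cons, eval, WHBTerm.eval, hf.map_inf, hf.map_sup] at ih ⊢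
    rw [ih, sup_inf_left, compl_inf, sup_sup_sup_comm]

theorem eval_sup (l m : WHBClauses) : eval f v (sup l m) = eval f v l ⊔ eval f v m := by
  induction l with
  | nil => exact (top_sup_eq _).symm
  | cons c l ih => rw [sup, eval_append, eval_supClause hf, ih, eval, sup_inf_right]

/-- The complement of `¬ s ∨ t` is `s ∧ ¬ t`, the meet of the clauses `(1, s)` and `(t, 0)`; each is
joined with the complement of the remaining list. -/
theorem eval_compl (l : WHBClauses) : eval f v (compl l) = (eval f v l)ᶜ := by
  induction l with
  | nil => simp [compl, eval, WHBTerm.eval, hf.map_top, hf.map_bot]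
  | cons c l ih =>
    rw [compl, eval_append, eval_supClause hf, eval_supClause hf, ih, eval, ← sup_inf_right,
      compl_inf, compl_sup, compl_compl]
    simp [WHBTerm.eval, hf.map_top, hf.map_bot]

theorem eval_box (l : WHBClauses) : eval f v (box l) = TenseAlgebra.G (eval f v l) := by
  induction l with
  | nil => exact TenseAlgebra.gc_P_G.u_top.symm
  | cons c l ih =>
    simp only [box, List.map_cons, eval, WHBTerm.eval, hf.map_top, hf.map_imp] at ih ⊢
    rw [ih, TenseAlgebra.G_inf, compl_top, bot_sup_eq]

/-- Clause by clause, `H(¬ s ∨ t) = ¬ P(s ∧ ¬ t)`, and `P(s ∧ ¬ t)` is the image of `s ← t`. -/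
theorem eval_backBox (l : WHBClauses) : eval f v (backBox l) = TenseAlgebra.H (eval f v l) := by
  induction l with
  | nil => exact TenseAlgebra.gc_F_H.u_top.symm
  | cons c l ih =>
    simp only [backBox, List.map_cons, eval, WHBTerm.eval, hf.map_bot, hf.map_diff] at ih ⊢
    rw [ih, TenseAlgebra.H_inf, TenseAlgebra.P, compl_compl, compl_inf, compl_compl,
      sup_bot_eq]

end WHBClauses

/-- A conjunctive normal form of a tense term over WHB-terms. -/
def TenseTerm.cnf : TenseTerm → WHBClauses
  | .var n => [(.top, .var n)]
  | .inf s t => s.cnf ++ t.cnf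
  | .sup s t => s.cnf.sup t.cnf
  | .compl s => s.cnf.compl
  | .G s => s.cnf.box
  | .H s => s.cnf.backBox
  | .bot => [(.top, .bot)]
  | .top => []

theorem IsHomToM.eval_cnf {A B : Type u} [WHBAlgebra A] [TenseAlgebra B] {f : A → B}
    (hf : IsHomToM f) (v : ℕ → A) (t : TenseTerm) :
    t.cnf.eval f v = t.eval (f ∘ v) := by
  induction t with
  | var n => simp [TenseTerm.cnf, WHBClauses.eval, WHBTerm.eval, TenseTerm.eval, hf.map_top]
  | inf s t hs ht => rw [TenseTerm.cnf, WHBClauses.eval_append, hs, ht, TenseTerm.eval]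
  | sup s t hs ht => rw [TenseTerm.cnf, WHBClauses.eval_sup hf, hs, ht, TenseTerm.eval]
  | compl s hs => rw [TenseTerm.cnf, WHBClauses.eval_compl hf, hs, TenseTerm.eval]
  | G s hs => rw [TenseTerm.cnf, WHBClauses.eval_box hf, hs, TenseTerm.eval]
  | H s hs => rw [TenseTerm.cnf, WHBClauses.eval_backBox hf, hs, TenseTerm.eval]
  | bot =>
    simp [TenseTerm.cnf, WHBClauses.eval, WHBTerm.eval, TenseTerm.eval, hf.map_top, hf.map_bot]
  | top => rfl

/-- A clause `¬ s ∨ t` equals `1` exactly when `s ≤ t`, that is, when `s ∧ t = s`, which is a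
WHB-equation. -/
theorem WHBClauses.eval_eq_top_iff {A B : Type u} [WHBAlgebra A] [TenseAlgebra B] {f : A → B}
    (hf : IsHomToM f) (v : ℕ → A) (l : WHBClauses) :
    l.eval f v = ⊤ ↔ ∀ c ∈ l, f ((WHBTerm.inf c.1 c.2).eval v) = f (c.1.eval v) := by
  induction l with
  | nil => simp [WHBClauses.eval]
  | cons c l ih =>
    rw [WHBClauses.eval, inf_eq_top_iff, ih, List.forall_mem_cons, WHBTerm.eval, hf.map_inf,
      inf_eq_left, sup_comm, ← himp_eq, himp_eq_top_iff]

/-- A term that takes the value `1` exactly where the equation `e` holds. -/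
def TenseTerm.ofEquation (e : TenseTerm × TenseTerm) : TenseTerm :=
  .inf (.sup (.compl e.1) e.2) (.sup (.compl e.2) e.1)

theorem TenseTerm.eval_ofEquation_eq_top_iff {B : Type u} [TenseAlgebra B] (v : ℕ → B)
    (e : TenseTerm × TenseTerm) :
    (TenseTerm.ofEquation e).eval v = ⊤ ↔ e.1.eval v = e.2.eval v := by
  simp only [TenseTerm.ofEquation, TenseTerm.eval]
  rw [inf_eq_top_iff, sup_comm, ← himp_eq, himp_eq_top_iff, sup_comm, ← himp_eq, himp_eq_top_iff]
  exact le_antisymm_iff.symm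

theorem IsHomToM.eval_eq_iff {A B : Type u} [WHBAlgebra A] [TenseAlgebra B] {f : A → B}
    (hf : IsHomToM f) (v : ℕ → A) (e : TenseTerm × TenseTerm) :
    e.1.eval (f ∘ v) = e.2.eval (f ∘ v) ↔ ∀ c ∈ (TenseTerm.ofEquation e).cnf,
      f ((WHBTerm.inf c.1 c.2).eval v) = f (c.1.eval v) := by
  rw [← TenseTerm.eval_ofEquation_eq_top_iff, ← hf.eval_cnf, WHBClauses.eval_eq_top_iff hf]

/-! ### Finite model property of a variety and its tense companion -/

theorem IsTenseCompanion.hasFMPTense {K : Set WHBAlg.{u}} {N : Set TenseAlg.{u}}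
    (h : IsTenseCompanion N K) (hK : HasFMPWHB K) : HasFMPTense N := by
  rintro e ⟨B, hB, he⟩
  obtain ⟨v, hv⟩ := not_forall.mp he
  have hv' := mt ((isHomToM_id B).eval_eq_iff v e).mpr hv
  push Not at hv'
  obtain ⟨c, hc, hcv⟩ := hv'
  -- One clause of the normal form of `e` fails in `M(B)`; its single equation is what gets refuted
  -- in a finite member of `K`.
  obtain ⟨A, hA, hfin, hAc⟩ := hK (.inf c.1 c.2, c.1)
    ⟨B.M, h.image_M_subset ⟨B, hB, rfl⟩, fun hval => hcv (hval v)⟩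
  refine ⟨A.T, h.image_T_subset ⟨A, hA, rfl⟩, A.finite_T, fun hval => hAc fun w => ?_⟩
  -- If `e` held in `T(A)`, every clause equation would hold on Stone images, hence in `A` by
  -- injectivity.
  exact A.toT_injective ((A.isHomToM_toT.eval_eq_iff w e).mp (hval _) c hc)

theorem IsTenseCompanion.hasFMPWHB {K : Set WHBAlg.{u}} {N : Set TenseAlg.{u}}
    (h : IsTenseCompanion N K) (hN : HasFMPTense N) : HasFMPWHB K := by
  rintro e ⟨A, hA, he⟩
  obtain ⟨B, hB, hfin, hBe⟩ := hN (e.1.toTense, e.2.toTense)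
    ⟨A.T, h.image_T_subset ⟨A, hA, rfl⟩, fun hval => he (WHBAlg.validates_of_T hval)⟩
  exact ⟨B.M, h.image_M_subset ⟨B, hB, rfl⟩, hfin, mt (B.validates_toTense_iff e).mpr hBe⟩

/-! ### Filtration through a finite Boolean subalgebra -/

/-- A finitely generated sublattice of a distributive lattice is finite, and the Boolean closure
consists of finite joins of differences of its elements. -/
theorem BooleanSubalgebra.finite_closure {B : Type u} [BooleanAlgebra B] {s : Set B}
    (hs : s.Finite) : Finite (BooleanSubalgebra.closure s) := by
  classical
  set L : Set B := latticeClosure (insert ⊥ (insert ⊤ s))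
  have hLfin : Finite L := ((hs.insert ⊤).insert ⊥).latticeClosure
  have hbot : ⊥ ∈ L := subset_latticeClosure (Set.mem_insert _ _)
  have htop : ⊤ ∈ L := subset_latticeClosure (Set.mem_insert_of_mem _ (Set.mem_insert _ _))
  have hsub : s ⊆ L := fun x hx =>
    subset_latticeClosure (Set.mem_insert_of_mem _ (Set.mem_insert_of_mem _ hx))
  have hfin : (Set.range fun t : Finset (L × L) =>
      t.sup fun x => (x.1.1 \ x.2.1 : B)).Finite := Set.finite_range _
  refine (hfin.subset fun x hx => ?_).to_subtype
  obtain ⟨t, ht⟩ := (BooleanSubalgebra.mem_closure_iff_sup_sdiff isSublattice_latticeClosure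
    hbot htop).mp (BooleanSubalgebra.closure_mono hsub hx)
  exact ⟨t, ht.symm⟩

section Filtration

variable {B : Type u} [TenseAlgebra B] (C : BooleanSubalgebra B) [Finite C]

/-- The greatest element of the finite subalgebra `C` below `x`. -/
noncomputable def BooleanSubalgebra.lowerApprox (x : B) : C :=
  (Set.toFinite {y : C | (y : B) ≤ x}).toFinset.sup id

/-- `lowerApprox` is right adjoint to the inclusion of `C` in `B`. -/
theorem BooleanSubalgebra.le_lowerApprox_iff {y : C} {x : B} :
    y ≤ C.lowerApprox x ↔ (y : B) ≤ x := by
  constructor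
  · intro h
    have hle : ((C.lowerApprox x : C) : B) ≤ x :=
      Finset.sup_induction (p := fun z : C => (z : B) ≤ x) bot_le (fun _ ha _ hb => sup_le ha hb)
        fun z hz => by simpa using hz
    exact le_trans (show (y : B) ≤ C.lowerApprox x from h) hle
  · intro h
    exact Finset.le_sup (f := id) (by simpa using h)

theorem BooleanSubalgebra.lowerApprox_of_mem {x : B} (hx : x ∈ C) :
    (C.lowerApprox x : B) = x :=
  le_antisymm (C.le_lowerApprox_iff.mp le_rfl)
    (show (⟨x, hx⟩ : C) ≤ C.lowerApprox x from C.le_lowerApprox_iff.mpr le_rfl)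

/-- The filtration of a tense algebra through a finite Boolean subalgebra. -/
@[reducible] noncomputable def TenseAlgebra.filtration : TenseAlgebra C where
  G x := C.lowerApprox (TenseAlgebra.G (x : B))
  H x := C.lowerApprox (TenseAlgebra.H (x : B))
  -- After moving the complement, both sides compare an element of `C` with an approximation, so
  -- both reduce to inequalities in `B`, where the adjunction is known.
  gc_P_G x y := by
    rw [compl_le_iff_compl_le, C.le_lowerApprox_iff, C.le_lowerApprox_iff, ← TenseAlgebra.gc,
      TenseAlgebra.P, compl_le_iff_compl_le]
    rfl
  gc_F_H x y := by
    rw [compl_le_iff_compl_le, C.le_lowerApprox_iff, C.le_lowerApprox_iff,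
      ← TenseAlgebra.gc_F_H (x : B) (y : B), compl_le_iff_compl_le]
    rfl

end Filtration

/-- The set of subterms of a tense term. -/
def TenseTerm.subterms : TenseTerm → Set TenseTerm
  | .var n => {.var n}
  | .inf s t => insert (.inf s t) (s.subterms ∪ t.subterms)
  | .sup s t => insert (.sup s t) (s.subterms ∪ t.subterms)
  | .compl s => insert (.compl s) s.subterms
  | .G s => insert (.G s) s.subterms
  | .H s => insert (.H s) s.subterms
  | .bot => {.bot}
  | .top => {.top}

theorem TenseTerm.finite_subterms (t : TenseTerm) : t.subterms.Finite := by
  induction t with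
  | var n => exact Set.finite_singleton _
  | inf s t hs ht => exact (hs.union ht).insert _
  | sup s t hs ht => exact (hs.union ht).insert _
  | compl s hs => exact hs.insert _
  | G s hs => exact hs.insert _
  | H s hs => exact hs.insert _
  | bot => exact Set.finite_singleton _
  | top => exact Set.finite_singleton _

theorem TenseTerm.self_mem_subterms (t : TenseTerm) : t ∈ t.subterms := by
  cases t <;> simp [TenseTerm.subterms]

/-- Approximation fixes elements of `C`, so the new operators agree with the old ones wherever the
value of a subterm `G s` or `H s` lies in `C`. -/
theorem TenseAlgebra.eval_filtration {B : Type u} [TenseAlgebra B] (C : BooleanSubalgebra B)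
    [Finite C] (v : ℕ → B) (w : ℕ → C) (hw : ∀ n, v n ∈ C → (w n : B) = v n) (t : TenseTerm)
    (ht : ∀ s ∈ t.subterms, s.eval v ∈ C) :
    ((@TenseTerm.eval C (TenseAlgebra.filtration C) w t : C) : B) = t.eval v := by
  induction t with
  | var n => exact hw n (ht _ (TenseTerm.self_mem_subterms _))
  | inf s t hs ht' =>
    exact congrArg₂ (· ⊓ ·) (hs fun r hr => ht r (Or.inr (Or.inl hr)))
      (ht' fun r hr => ht r (Or.inr (Or.inr hr)))
  | sup s t hs ht' =>
    exact congrArg₂ (· ⊔ ·) (hs fun r hr => ht r (Or.inr (Or.inl hr)))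
      (ht' fun r hr => ht r (Or.inr (Or.inr hr)))
  | compl s hs => exact congrArg (·ᶜ) (hs fun r hr => ht r (Or.inr hr))
  | G s hs =>
    have h := hs fun r hr => ht r (Or.inr hr)
    exact (congrArg (fun x => (C.lowerApprox (TenseAlgebra.G x) : B)) h).trans
      (C.lowerApprox_of_mem (ht _ (TenseTerm.self_mem_subterms _)))
  | H s hs =>
    have h := hs fun r hr => ht r (Or.inr hr)
    exact (congrArg (fun x => (C.lowerApprox (TenseAlgebra.H x) : B)) h).trans
      (C.lowerApprox_of_mem (ht _ (TenseTerm.self_mem_subterms _)))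
  | bot => rfl
  | top => rfl

/-! ### Finite model property of the two full varieties -/

theorem hasFMPTense_univ : HasFMPTense (Set.univ : Set TenseAlg.{u}) := by
  classical
  rintro e ⟨B, -, he⟩
  obtain ⟨v, hv⟩ := not_forall.mp he
  set C : BooleanSubalgebra B.carrier :=
    BooleanSubalgebra.closure ((fun t => t.eval v) '' (e.1.subterms ∪ e.2.subterms))
  have hC : Finite C := BooleanSubalgebra.finite_closure
    ((e.1.finite_subterms.union e.2.finite_subterms).image _)
  -- Variables occurring in `e` have values in `C`, so the default `⊥` only concerns variables that
  -- do not occur.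
  let w : ℕ → C := fun n => if h : v n ∈ C then ⟨v n, h⟩ else ⊥
  have hw : ∀ n, v n ∈ C → (w n : B.carrier) = v n := fun n h => by simp only [w, dif_pos h]
  refine ⟨@TenseAlg.mk C (TenseAlgebra.filtration C), trivial, hC, fun hval => hv ?_⟩
  rw [← TenseAlgebra.eval_filtration C v w hw e.1
      fun s hs => BooleanSubalgebra.subset_closure ⟨s, Or.inl hs, rfl⟩,
    ← TenseAlgebra.eval_filtration C v w hw e.2
      fun s hs => BooleanSubalgebra.subset_closure ⟨s, Or.inr hs, rfl⟩]
  exact congrArg Subtype.val (hval w)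

theorem isTenseCompanion_univ :
    IsTenseCompanion (Set.univ : Set TenseAlg.{u}) (Set.univ : Set WHBAlg.{u}) :=
  ⟨⟨∅, by simp⟩, Set.subset_univ _, Set.subset_univ _⟩

theorem mainTheorem8 :
    (∀ K : Set WHBAlg.{u}, IsVarietyWHB K → ∀ N : Set TenseAlg.{u}, IsTenseCompanion N K →
      (HasFMPWHB K ↔ HasFMPTense N)) ∧
    HasFMPTense (Set.univ : Set TenseAlg.{u}) ∧
    HasFMPWHB (Set.univ : Set WHBAlg.{u}) :=
  ⟨fun _ _ _ h => ⟨h.hasFMPTense, h.hasFMPWHB⟩, hasFMPTense_univ,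
    isTenseCompanion_univ.hasFMPWHB hasFMPTense_univ⟩
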